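/- Fix modal formulas built from countably many propositional variables with the classical connectives and $\Box$, coded by natural numbers through a standard Gödel numbering. A (normal modal) logic is a set of formulas that contains all classical tautologies and $\Box(p\to q)\to(\Box p\to\Box q)$ and is closed under modus ponens, necessitation and uniform substitution. Let $\mathsf{K}$ be the least normal modal logic, let $\mathrm{NExt}\,\mathsf{K}$ be the complete lattice of all normal modal logics ordered by inclusion, and for a formula $\varphi$ let $\mathsf{K}+\varphi$ be the least normal modal logic containing $\varphi$. A splitting pair of a complete lattice $X$ is a pair $(x,y)\in X^2$ such that $x\not\le y$ and, for every $z\in X$, $x\le z$ or $z\le y$; then $x$ is called a splitting in $X$. A union-splitting in $\mathrm{NExt}\,\mathsf{K}$ is a logic that is the join in $\mathrm{NExt}\,\mathsf{K}$ of a (possibly empty) set of splittings in $\mathrm{NExt}\,\mathsf{K}$. **Lemma.** Let $\varphi$ be a formula such that $\mathsf{K}+\varphi$ is a union-splitting in $\mathrm{NExt}\,\mathsf{K}$. Then the axiomatization problem for $\mathsf{K}+\varphi$ is decidable: the set of formulas $\psi$ with $\mathsf{K}+\psi=\mathsf{K}+\varphi$ is decidable. Moreover, a decision procedure can be obtained effectively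 from $\varphi$: there is a computable function $F$ from formulas to programs such that, for every formula $\varphi$ for which $\mathsf{K}+\varphi$ is a union-splitting in $\mathrm{NExt}\,\mathsf{K}$, the program $F(\varphi)$ halts on every formula $\psi$ and decides whether $\mathsf{K}+\psi=\mathsf{K}+\varphi$. -/

import Mathlib

/-- Modal formulas over the propositional variables `p₀, p₁, …`, with primitive connectives
`⊥`, `→`, `□`; the other connectives are the usual classical abbreviations. -/
inductive ModalFormula : Type
  | bot : ModalFormula
  | var : ℕ → ModalFormula
  | box : ModalFormula → ModalFormula
  | imp : ModalFormula → ModalFormula → ModalFormula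

namespace ModalFormula

/-- Simultaneous substitution of formulas for variables. -/
def subst (σ : ℕ → ModalFormula) : ModalFormula → ModalFormula
  | bot => bot
  | var n => σ n
  | box a => box (subst σ a)
  | imp a b => imp (subst σ a) (subst σ b)

/-- Gödel numbering of formulas. -/
def encodeFormula : ModalFormula → ℕ
  | bot => 0
  | var n => 3 * n + 1
  | box a => 3 * encodeFormula a + 2
  | imp a b => 3 * Nat.pair (encodeFormula a) (encodeFormula b) + 3

/-- The inverse of the Gödel numbering. -/
def decodeFormula : ℕ → ModalFormula
  | 0 => bot
  | n + 1 =>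
    have h0 : n / 3 < n + 1 := Nat.lt_succ_of_le (Nat.div_le_self n 3)
    have h1 : (n / 3).unpair.1 < n + 1 := lt_of_le_of_lt (Nat.unpair_left_le _) h0
    have h2 : (n / 3).unpair.2 < n + 1 := lt_of_le_of_lt (Nat.unpair_right_le _) h0
    if n % 3 = 0 then var (n / 3)
    else if n % 3 = 1 then box (decodeFormula (n / 3))
    else imp (decodeFormula (n / 3).unpair.1) (decodeFormula (n / 3).unpair.2)

theorem decode_encodeFormula (a : ModalFormula) : decodeFormula (encodeFormula a) = a := by
  induction a with
  | bot => simp [encodeFormula, decodeFormula]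
  | var n =>
    have h1 : 3 * n / 3 = n := by omega
    rw [encodeFormula, decodeFormula]
    simp [h1]
  | box a ih =>
    have h1 : (3 * encodeFormula a + 1) / 3 = encodeFormula a := by omega
    have h2 : (3 * encodeFormula a + 1) % 3 = 1 := by omega
    rw [encodeFormula, decodeFormula]
    simp [h1, h2, ih]
  | imp a b iha ihb =>
    have h1 : (3 * Nat.pair (encodeFormula a) (encodeFormula b) + 2) / 3
        = Nat.pair (encodeFormula a) (encodeFormula b) := by omega
    have h2 : (3 * Nat.pair (encodeFormula a) (encodeFormula b) + 2) % 3 = 2 := by omega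
    rw [encodeFormula, decodeFormula]
    simp [h1, h2, iha, ihb]

theorem encode_decodeFormula (n : ℕ) : encodeFormula (decodeFormula n) = n := by
  induction n using Nat.strong_induction_on with
  | _ n ih =>
    cases n with
    | zero => simp [encodeFormula, decodeFormula]
    | succ n =>
      have h0 : n / 3 < n + 1 := Nat.lt_succ_of_le (Nat.div_le_self n 3)
      have h1 : (n / 3).unpair.1 < n + 1 := lt_of_le_of_lt (Nat.unpair_left_le _) h0
      have h2 : (n / 3).unpair.2 < n + 1 := lt_of_le_of_lt (Nat.unpair_right_le _) h0
      rw [decodeFormula]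
      split_ifs with h h'
      · rw [encodeFormula]; omega
      · rw [encodeFormula, ih _ h0]; omega
      · rw [encodeFormula, ih _ h1, ih _ h2, Nat.pair_unpair]; omega

/-- Formulas are coded by natural numbers through the Gödel numbering; Mathlib's computability
notions for formulas (`Computable`, `ComputablePred`) refer to this coding. -/
instance : Denumerable ModalFormula :=
  Denumerable.mk' ⟨encodeFormula, decodeFormula, decode_encodeFormula, encode_decodeFormula⟩

end ModalFormula

open ModalFormula in
/-- A normal modal logic: a set of formulas containing classical propositional logic
(axiomatized by the three schemes `ax_weak`, `ax_distr`, `ax_dne` and modus ponens) and the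
distribution axiom for `□`, closed under modus ponens, necessitation and uniform substitution. -/
@[ext] structure NormalLogic : Type where
  carrier : Set ModalFormula
  ax_weak : ∀ a b, imp a (imp b a) ∈ carrier
  ax_distr : ∀ a b c, imp (imp a (imp b c)) (imp (imp a b) (imp a c)) ∈ carrier
  ax_dne : ∀ a, imp (imp (imp a bot) bot) a ∈ carrier
  ax_box : ∀ a b, imp (box (imp a b)) (imp (box a) (box b)) ∈ carrier
  mp : ∀ a b, imp a b ∈ carrier → a ∈ carrier → b ∈ carrier
  nec : ∀ a, a ∈ carrier → box a ∈ carrier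
  subst_mem : ∀ (σ : ℕ → ModalFormula) (a), a ∈ carrier → a.subst σ ∈ carrier

namespace NormalLogic

/-- Logics are ordered by inclusion. -/
instance : PartialOrder NormalLogic where
  le L M := L.carrier ⊆ M.carrier
  le_refl _ := Set.Subset.rfl
  le_trans _ _ _ h k := Set.Subset.trans h k
  le_antisymm _ _ h k := NormalLogic.ext (Set.Subset.antisymm h k)

/-- The infimum of a set of logics is their intersection. -/
instance : InfSet NormalLogic where
  sInf S :=
    { carrier := {a | ∀ L ∈ S, a ∈ L.carrier}
      ax_weak := fun a b L _ => L.ax_weak a b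
      ax_distr := fun a b c L _ => L.ax_distr a b c
      ax_dne := fun a L _ => L.ax_dne a
      ax_box := fun a b L _ => L.ax_box a b
      mp := fun a b h k L hL => L.mp a b (h L hL) (k L hL)
      nec := fun a h L hL => L.nec a (h L hL)
      subst_mem := fun σ a h L hL => L.subst_mem σ a (h L hL) }

/-- The complete lattice of all normal modal logics, that is, `NExt K`. -/
instance : CompleteLattice NormalLogic :=
  completeLatticeOfInf NormalLogic fun _ =>
    ⟨fun _ hL _ ha => ha _ hL, fun _ hM _ ha L hL => hM hL ha⟩

/-- The logic `K`: the least normal modal logic. -/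
def K : NormalLogic := ⊥

/-- `L₀ + φ`: the least normal modal logic that contains `L₀` and `φ`. -/
def add (L₀ : NormalLogic) (φ : ModalFormula) : NormalLogic :=
  sInf {L | L₀ ≤ L ∧ φ ∈ L.carrier}

end NormalLogic

/-- `(x, y)` is a splitting pair: `x ≰ y`, and every `z` satisfies `x ≤ z` or `z ≤ y`. -/
def IsSplittingPair {X : Type*} [CompleteLattice X] (x y : X) : Prop :=
  ¬ x ≤ y ∧ ∀ z, x ≤ z ∨ z ≤ y

/-- `x` is a splitting: it is the first component of a splitting pair. -/
def IsSplitting {X : Type*} [CompleteLattice X] (x : X) : Prop :=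
  ∃ y, IsSplittingPair x y

/-- `x` is a union-splitting: it is the join of a (possibly empty) set of splittings. -/
def IsUnionSplitting {X : Type*} [CompleteLattice X] (x : X) : Prop :=
  ∃ S : Set X, (∀ s ∈ S, IsSplitting s) ∧ x = sSup S

/-- The axiomatization problem for `L₀ + φ`: the set of `ψ` with `L₀ + ψ = L₀ + φ`. -/
def AxiomatizationProblem (L₀ : NormalLogic) (φ ψ : ModalFormula) : Prop :=
  L₀.add ψ = L₀.add φ

/-- The program `c` decides `p`: on (the code of) every formula `ψ` it halts, with output `1` if
`p ψ` holds and with output `0` if not. -/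
def Nat.Partrec.Code.Decides (c : Nat.Partrec.Code) (p : ModalFormula → Prop) : Prop :=
  ∀ ψ, (p ψ → c.eval (Encodable.encode ψ) = Part.some 1) ∧
    (¬ p ψ → c.eval (Encodable.encode ψ) = Part.some 0)

/-! Equality of `K + φ` and `K + ψ` is semidecidable for arbitrary formulas: search for a derivation
of each formula from the other. When `K + φ` is a union-splitting, inequality is semidecidable too,
because it is always witnessed by a finite frame validating exactly one of the two formulas.
Searching for both kinds of certificate at once is uniform in `φ`.

The finite frames come from two facts. First, `K` is the intersection of the logics `K + □ⁿ⊥`, since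
a refuting model can be cut off at finite height. Hence, for a splitting pair `(x, y)`, the
companion `y` contains some `□ⁿ⊥`: otherwise `x` lies below every `K + □ⁿ⊥`, hence below `K`. It
follows that `x` is axiomatized by one formula `□ⁿ⊥ → θ`. Second, `exists_finite_frame` filters a
model of a logic `L` so finely that the finite quotient frame validates every theorem of `L` of the
form `□ⁿ⊥ → θ`.

If `ψ ∉ K + φ`, then `φ` follows from theorems `□ᵐ⊥ → θ` of `K + φ` with `m` bounded, so filtration
gives a finite frame for `φ` refuting `ψ`. If `φ ∉ K + ψ`, some splitting `s ≤ K + φ` is not below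
`K + ψ`, so `K + ψ` is below the companion `y` of `s`. Filtration for `y`, which contains `□ⁿ⊥`,
gives a finite frame for `ψ` refuting a theorem of `s`, hence refuting `φ`. -/

namespace ModalFormula

/-! ### Kripke semantics and the formulas `□ⁿ⊥` -/

/-- Truth of a formula at a point of a Kripke model. -/
def Forces {W : Type*} (R : W → W → Prop) (V : ℕ → W → Prop) : W → ModalFormula → Prop
  | _, bot => False
  | w, var n => V n w
  | w, box a => ∀ v, R w v → Forces R V v a
  | w, imp a b => Forces R V w a → Forces R V w b

/-- Validity of a formula in a Kripke frame. -/
def Valid {W : Type*} (R : W → W → Prop) (a : ModalFormula) : Prop :=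
  ∀ V w, Forces R V w a

theorem forces_subst {W : Type*} (R : W → W → Prop) (V : ℕ → W → Prop) (σ : ℕ → ModalFormula)
    (a : ModalFormula) (w : W) :
    Forces R V w (a.subst σ) ↔ Forces R (fun n v => Forces R V v (σ n)) w a := by
  induction a generalizing w with
  | bot => rfl
  | var n => rfl
  | box a ih => exact forall₂_congr fun v _ => ih v
  | imp a b iha ihb => exact imp_congr (iha w) (ihb w)

theorem subst_subst (σ τ : ℕ → ModalFormula) (a : ModalFormula) :
    (a.subst σ).subst τ = a.subst fun n => (σ n).subst τ := by
  induction a with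
  | bot => rfl
  | var n => rfl
  | box a ih => simp [subst, ih]
  | imp a b iha ihb => simp [subst, iha, ihb]

theorem subst_var (a : ModalFormula) : a.subst var = a := by
  induction a with
  | bot => rfl
  | var n => rfl
  | box a ih => simp [subst, ih]
  | imp a b iha ihb => simp [subst, iha, ihb]

/-- The formula `□ⁿ⊥`, saying that every chain of successors has length less than `n`. -/
def boxBot : ℕ → ModalFormula
  | 0 => bot
  | n + 1 => box (boxBot n)

theorem forces_boxBot_mono {W : Type*} {R : W → W → Prop} {V : ℕ → W → Prop} {m n : ℕ}
    (h : m ≤ n) {w : W} (hw : Forces R V w (boxBot m)) : Forces R V w (boxBot n) := by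
  induction m generalizing n w with
  | zero => exact hw.elim
  | succ m ih =>
    obtain ⟨n, rfl⟩ : ∃ k, n = k + 1 := ⟨n - 1, by omega⟩
    exact fun v hv => ih (by omega) (hw v hv)

theorem forces_boxBot_succ {W : Type*} {R : W → W → Prop} {V : ℕ → W → Prop} {n : ℕ} {w v : W}
    (hw : Forces R V w (boxBot n)) (h : R w v) : Forces R V v (boxBot n) :=
  (forces_boxBot_mono (Nat.le_succ n) hw : Forces R V w (boxBot (n + 1))) v h

theorem forces_boxBot_congr {W : Type*} {R : W → W → Prop} (V V' : ℕ → W → Prop) (n : ℕ) (w : W) :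
    Forces R V w (boxBot n) ↔ Forces R V' w (boxBot n) := by
  induction n generalizing w with
  | zero => rfl
  | succ n ih => exact forall₂_congr fun v _ => ih v

/-- The set of subformulas. -/
def subformulas : ModalFormula → Set ModalFormula
  | bot => {bot}
  | var n => {var n}
  | box a => insert (box a) (subformulas a)
  | imp a b => insert (imp a b) (subformulas a ∪ subformulas b)

theorem mem_subformulas_self (a : ModalFormula) : a ∈ subformulas a := by
  cases a <;> simp [subformulas]

theorem finite_subformulas (a : ModalFormula) : (subformulas a).Finite := by
  induction a with
  | bot => exact Set.finite_singleton _
  | var n => exact Set.finite_singleton _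
  | box a ih => exact ih.insert _
  | imp a b iha ihb => exact (iha.union ihb).insert _

end ModalFormula

open ModalFormula

/-! ### Logics of frames and canonical-model completeness -/

namespace NormalLogic

/-- The logic of a Kripke frame. -/
def ofFrame {W : Type*} (R : W → W → Prop) : NormalLogic where
  carrier := {a | Valid R a}
  ax_weak _ _ _ _ ha _ := ha
  ax_distr _ _ _ _ _ h k ha := h ha (k ha)
  ax_dne _ _ _ h := not_not.1 h
  ax_box _ _ _ _ h k v hv := h v hv (k v hv)
  mp _ _ h k V w := h V w (k V w)
  nec _ h V _ v _ := h V v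
  subst_mem σ a h V w := (forces_subst R V σ a w).2 (h _ w)

theorem le_add (L : NormalLogic) (a : ModalFormula) : L ≤ L.add a :=
  le_sInf fun _ h => h.1

theorem mem_add (L : NormalLogic) (a : ModalFormula) : a ∈ (L.add a).carrier :=
  fun _ h => h.2

theorem add_le_iff {L M : NormalLogic} {a : ModalFormula} : L.add a ≤ M ↔ L ≤ M ∧ a ∈ M.carrier :=
  ⟨fun h => ⟨(L.le_add a).trans h, h (L.mem_add a)⟩, fun h => sInf_le h⟩

theorem K_add_le_iff {M : NormalLogic} {a : ModalFormula} : K.add a ≤ M ↔ a ∈ M.carrier :=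
  add_le_iff.trans (and_iff_right bot_le)

section Hilbert

variable {L : NormalLogic}

/-- A theory over `L`: a set of formulas containing `L` and closed under modus ponens. -/
structure IsTheory (L : NormalLogic) (S : Set ModalFormula) : Prop where
  sub : L.carrier ⊆ S
  mp : ∀ {a b}, imp a b ∈ S → a ∈ S → b ∈ S

namespace IsTheory

variable {S : Set ModalFormula} {a b c : ModalFormula}

theorem weak (hS : IsTheory L S) (h : a ∈ S) : imp b a ∈ S := hS.mp (hS.sub (L.ax_weak a b)) h

/-- The theory generated by `S` and `a`. -/
theorem extend (hS : IsTheory L S) (a : ModalFormula) : IsTheory L {c | imp a c ∈ S} where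
  sub _ hc := hS.weak (hS.sub hc)
  mp h k := hS.mp (hS.mp (hS.sub (L.ax_distr _ _ _)) h) k

theorem imp_self (hS : IsTheory L S) (a : ModalFormula) : imp a a ∈ S :=
  hS.mp (hS.mp (hS.sub (L.ax_distr a (imp a a) a)) (hS.sub (L.ax_weak _ _)))
    (hS.sub (L.ax_weak _ _))

theorem dne (hS : IsTheory L S) (h : imp (imp a bot) bot ∈ S) : a ∈ S :=
  hS.mp (hS.sub (L.ax_dne a)) h

theorem explosion (hS : IsTheory L S) (h : bot ∈ S) : a ∈ S := hS.dne (hS.weak h)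

/-- A theory maximal among those omitting `a` contains `b → a` for each `b` outside it. By this law
`b` and `b → c` cannot both be outside, so such a theory is complete. -/
theorem peirce (hS : IsTheory L S) (h : imp b a ∈ S) (k : imp (imp b c) a ∈ S) : a ∈ S := by
  have hT := hS.extend (imp a bot)
  refine hS.dne (hT.mp (hS.imp_self _) ?_)
  refine hT.mp (hS.weak k) ?_
  have hU := hT.extend b
  exact hU.explosion (hU.mp (hT.weak (hS.imp_self _)) (hS.weak h))

/-- Lindenbaum's lemma. -/
theorem exists_maximal (hS : IsTheory L S) (ha : a ∉ S) :
    ∃ T, IsTheory L T ∧ S ⊆ T ∧ a ∉ T ∧ ∀ b, b ∉ T → imp b a ∈ T := by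
  have hchains : ∀ c ⊆ {T | IsTheory L T ∧ a ∉ T}, IsChain (· ⊆ ·) c → c.Nonempty →
      ∃ ub ∈ {T | IsTheory L T ∧ a ∉ T}, ∀ s ∈ c, s ⊆ ub := by
    rintro c hc hchain ⟨X, hX⟩
    refine ⟨⋃₀ c, ⟨⟨fun b hb => ⟨X, hX, (hc hX).1.sub hb⟩, ?_⟩, ?_⟩,
      fun s hs => Set.subset_sUnion_of_mem hs⟩
    · rintro b d ⟨Y, hY, hbd⟩ ⟨Z, hZ, hb⟩
      rcases hchain.total hY hZ with h | h
      · exact ⟨Z, hZ, (hc hZ).1.mp (h hbd) hb⟩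
      · exact ⟨Y, hY, (hc hY).1.mp hbd (h hb)⟩
    · rintro ⟨Y, hY, h⟩
      exact (hc hY).2 h
  obtain ⟨T, hST, hT⟩ := zorn_subset_nonempty _ hchains S ⟨hS, ha⟩
  refine ⟨T, hT.1.1, hST, hT.1.2, fun b hb => by_contra fun h => hb ?_⟩
  -- The theory generated by `T` and `b` still omits `a`, so by maximality it equals `T`, and it
  -- contains `b`.
  exact hT.2 (y := {c | imp b c ∈ T}) ⟨hT.1.1.extend b, h⟩ (fun c hc => hT.1.1.weak hc)
    (hT.1.1.imp_self b)

end IsTheory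

/-- Points of the canonical model: complete consistent theories. -/
structure CanonicalPoint (L : NormalLogic) where
  carrier : Set ModalFormula
  isTheory : IsTheory L carrier
  bot_notMem : bot ∉ carrier
  imp_mem : ∀ b c, b ∉ carrier → imp b c ∈ carrier

theorem IsTheory.exists_canonicalPoint {S : Set ModalFormula} {a : ModalFormula}
    (hS : IsTheory L S) (ha : a ∉ S) :
    ∃ w : CanonicalPoint L, S ⊆ w.carrier ∧ a ∉ w.carrier := by
  obtain ⟨T, hT, hST, haT, hmax⟩ := hS.exists_maximal ha
  exact ⟨⟨T, hT, fun h => haT (hT.explosion h), fun b c hb => by_contra fun h =>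
    haT (hT.peirce (hmax _ hb) (hmax _ h))⟩, hST, haT⟩

/-- Accessibility in the canonical model. -/
def canonicalRel (w v : CanonicalPoint L) : Prop :=
  ∀ a, box a ∈ w.carrier → a ∈ v.carrier

theorem forces_canonical (a : ModalFormula) (w : CanonicalPoint L) :
    Forces canonicalRel (fun n (v : CanonicalPoint L) => var n ∈ v.carrier) w a ↔
      a ∈ w.carrier := by
  induction a generalizing w with
  | bot => exact ⟨False.elim, w.bot_notMem⟩
  | var n => rfl
  | box a ih =>
    refine ⟨fun h => by_contra fun hn => ?_, fun h v hv => (ih v).2 (hv a h)⟩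
    -- Necessitation and the distribution axiom make this set a theory; a canonical point extending
    -- it and omitting `a` is the required successor.
    have hS : IsTheory L {b | box b ∈ w.carrier} :=
      ⟨fun b hb => w.isTheory.sub (L.nec b hb), fun h k =>
        w.isTheory.mp (w.isTheory.mp (w.isTheory.sub (L.ax_box _ _)) h) k⟩
    obtain ⟨v, hv, hav⟩ := hS.exists_canonicalPoint hn
    exact hav ((ih v).1 (h v hv))
  | imp a b iha ihb =>
    refine (imp_congr (iha w) (ihb w)).trans ⟨fun h => ?_, w.isTheory.mp⟩
    by_cases ha : a ∈ w.carrier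
    · exact w.isTheory.weak (h ha)
    · exact w.imp_mem a b ha

/-- Every logic is complete for Kripke models in which it is true everywhere. -/
theorem exists_model {a : ModalFormula} (ha : a ∉ L.carrier) :
    ∃ (W : Type) (R : W → W → Prop) (V : ℕ → W → Prop),
      (∀ b ∈ L.carrier, ∀ w, Forces R V w b) ∧ ∃ w, ¬ Forces R V w a := by
  obtain ⟨w, -, hw⟩ := (IsTheory.mk subset_rfl fun {b c} => L.mp b c).exists_canonicalPoint ha
  exact ⟨CanonicalPoint L, canonicalRel, _, fun b hb w =>
    (forces_canonical b w).2 (w.isTheory.sub hb), w, fun h => hw ((forces_canonical a w).1 h)⟩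

end Hilbert

/-! ### Truncation: `K` as an intersection -/

/-- Cutting a frame off at height `n`. -/
def truncRel {W : Type*} (R : W → W → Prop) (n : ℕ) (p q : W × Fin n) : Prop :=
  R p.1 q.1 ∧ (p.2 : ℕ) = q.2 + 1

/-- The second coordinate counts the steps still allowed, and `d` can be the modal depth of `a`:
with that many steps left, evaluation never meets the cut. -/
theorem forces_truncRel {W : Type*} (R : W → W → Prop) (V : ℕ → W → Prop) (a : ModalFormula) :
    ∃ d : ℕ, ∀ n (p : W × Fin n), d ≤ (p.2 : ℕ) →
      (Forces (truncRel R n) (fun k q => V k q.1) p a ↔ Forces R V p.1 a) := by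
  induction a with
  | bot => exact ⟨0, fun _ _ _ => Iff.rfl⟩
  | var n => exact ⟨0, fun _ _ _ => Iff.rfl⟩
  | box a ih =>
    obtain ⟨d, hd⟩ := ih
    refine ⟨d + 1, fun n p hp => ⟨fun h v hv => ?_, fun h q hq => ?_⟩⟩
    · have hlt : (p.2 : ℕ) - 1 < n := by omega
      exact (hd n (v, ⟨p.2 - 1, hlt⟩) (by simp; omega)).1 (h _ ⟨hv, by simp; omega⟩)
    · exact (hd n q (by have := hq.2; omega)).2 (h _ hq.1)
  | imp a b iha ihb =>
    obtain ⟨d, hd⟩ := iha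
    obtain ⟨e, he⟩ := ihb
    exact ⟨max d e, fun n p hp => imp_congr (hd n p ((le_max_left _ _).trans hp))
      (he n p ((le_max_right _ _).trans hp))⟩

theorem valid_truncRel_boxBot {W : Type*} (R : W → W → Prop) (n : ℕ) :
    Valid (truncRel R n) (boxBot n) := by
  have key (V : ℕ → W × Fin n → Prop) (k : ℕ) (p : W × Fin n) (h : (p.2 : ℕ) < k) :
      Forces (truncRel R n) V p (boxBot k) := by
    induction k generalizing p with
    | zero => omega
    | succ k ih => exact fun q hq => ih q (by have := hq.2; omega)
  exact fun V p => key V n p p.2.2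

/-- `K` is the intersection of the logics `K + □ⁿ⊥`. -/
theorem exists_notMem_K_add_boxBot {a : ModalFormula} (ha : a ∉ K.carrier) :
    ∃ n, a ∉ (K.add (boxBot n)).carrier := by
  obtain ⟨W, R, V, -, w, hw⟩ := exists_model ha
  obtain ⟨d, hd⟩ := forces_truncRel R V a
  refine ⟨d + 1, fun h => hw ?_⟩
  have hle : K.add (boxBot (d + 1)) ≤ ofFrame (truncRel R (d + 1)) :=
    K_add_le_iff.2 (valid_truncRel_boxBot R (d + 1))
  -- Height `d + 1` is the least that has a copy of `w` with `d` steps left.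
  exact (hd (d + 1) (w, Fin.last d) (by simp)).1 (hle h _ _)

end NormalLogic

/-! ### Filtration through types of finite height -/

namespace ModalFormula

section Filtration

variable {W : Type*} {R : W → W → Prop} {V : ℕ → W → Prop}

/-- A property of points of a model is definable if it is the truth set of a formula. -/
def Definable (R : W → W → Prop) (V : ℕ → W → Prop) (P : W → Prop) : Prop :=
  ∃ a, ∀ w, Forces R V w a ↔ P w

namespace Definable

variable {P Q : W → Prop}

theorem congr (hP : Definable R V P) (h : ∀ w, P w ↔ Q w) : Definable R V Q :=
  hP.imp fun _ ha w => (ha w).trans (h w)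

theorem not (hP : Definable R V P) : Definable R V fun w => ¬ P w :=
  let ⟨a, ha⟩ := hP
  ⟨imp a bot, fun w => imp_congr (ha w) Iff.rfl⟩

theorem and (hP : Definable R V P) (hQ : Definable R V Q) : Definable R V fun w => P w ∧ Q w := by
  obtain ⟨a, ha⟩ := hP
  obtain ⟨b, hb⟩ := hQ
  refine ⟨imp (imp a (imp b bot)) bot, fun w => ?_⟩
  simp only [Forces, ha, hb]
  tauto

theorem box (hP : Definable R V P) : Definable R V fun w => ∀ v, R w v → P v :=
  let ⟨a, ha⟩ := hP
  ⟨.box a, fun _ => forall₂_congr fun v _ => ha v⟩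

theorem dia (hP : Definable R V P) : Definable R V fun w => ∃ v, R w v ∧ P v :=
  hP.not.box.not.congr fun w => by simp

theorem iff_const (hP : Definable R V P) (p : Prop) : Definable R V fun w => P w ↔ p := by
  by_cases hp : p
  · exact hP.congr fun w => by simp [hp]
  · exact hP.not.congr fun w => by simp [hp]

theorem forall_finite {ι : Type*} [Finite ι] {P : ι → W → Prop} (h : ∀ i, Definable R V (P i)) :
    Definable R V fun w => ∀ i, P i w := by
  have := Fintype.ofFinite ι
  suffices ∀ s : Finset ι, Definable R V fun w => ∀ i ∈ s, P i w from
    (this Finset.univ).congr fun w => by simp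
  intro s
  classical
  induction s using Finset.induction_on with
  | empty => exact ⟨imp bot bot, fun w => by simp [Forces]⟩
  | insert i s _ ih => exact ((h i).and ih).congr fun w => by simp

theorem exists_finite {ι : Type*} [Finite ι] {P : ι → W → Prop} (h : ∀ i, Definable R V (P i)) :
    Definable R V fun w => ∃ i, P i w :=
  (forall_finite fun i => (h i).not).not.congr fun w => by simp

end Definable

variable {H : Type*} {f : W → H} {Γ : Set ModalFormula}

/-- The filtration lemma for the smallest filtration. -/
theorem forces_filtration (hΓ : ∀ w w', f w = f w' → ∀ a ∈ Γ, (Forces R V w a ↔ Forces R V w' a))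
    {a : ModalFormula} (ha : subformulas a ⊆ Γ) (w : W) :
    Forces (Relation.Map R f f) (fun k h => ∃ v, f v = h ∧ Forces R V v (var k)) (f w) a ↔
      Forces R V w a := by
  induction a generalizing w with
  | bot => rfl
  | var n => exact ⟨fun ⟨v, hv, h⟩ => (hΓ v w hv _ (ha rfl)).1 h, fun h => ⟨w, rfl, h⟩⟩
  | box a ih =>
    have ih := ih ((Set.subset_insert _ _).trans ha)
    refine ⟨fun h v hv => (ih v).1 (h _ ⟨w, v, hv, rfl, rfl⟩), ?_⟩
    rintro h _ ⟨w', v, hR, hw, rfl⟩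
    exact (ih v).2 ((hΓ w' w hw _ (ha (mem_subformulas_self _))).2 h v hR)
  | imp a b iha ihb =>
    exact imp_congr (iha ((Set.subset_union_left.trans (Set.subset_insert _ _)).trans ha) w)
      (ihb ((Set.subset_union_right.trans (Set.subset_insert _ _)).trans ha) w)

/-- If a map with definable fibres is a bisimulation on the points forcing `□ⁿ⊥`, truth in its
image under any valuation is truth of a substitution instance at such points. -/
theorem forces_map_iff_subst {n : ℕ} {σ : ℕ → ModalFormula} {U : ℕ → H → Prop}
    (hf : ∀ w w' v', Forces R V w (boxBot n) → f w = f w' → R w' v' → ∃ v, R w v ∧ f v = f v')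
    (hσ : ∀ k w, Forces R V w (σ k) ↔ U k (f w)) (a : ModalFormula) {w : W}
    (hw : Forces R V w (boxBot n)) :
    Forces (Relation.Map R f f) U (f w) a ↔ Forces R V w (a.subst σ) := by
  induction a generalizing w with
  | bot => rfl
  | var k => exact (hσ k w).symm
  | box a ih =>
    refine ⟨fun h v hv => (ih (forces_boxBot_succ hw hv)).1 (h _ ⟨w, v, hv, rfl, rfl⟩), ?_⟩
    rintro h _ ⟨w', v', hR, hw', rfl⟩
    obtain ⟨v, hv, hvv'⟩ := hf w w' v' hw hw'.symm hR
    rw [← hvv']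
    exact (ih (forces_boxBot_succ hw hv)).2 (h v hv)
  | imp a b iha ihb => exact imp_congr (iha hw) (ihb hw)

variable (Γ) in
/-- Types of height `k` over `Γ`: possible descriptions of a point by the formulas of `Γ` that it
forces and the types of height `k - 1` of its successors. -/
def PointType : ℕ → Type
  | 0 => Set Γ
  | k + 1 => Set Γ × Set (PointType k)

theorem finite_pointType (hΓ : Γ.Finite) (k : ℕ) : Finite (PointType Γ k) := by
  have := hΓ.to_subtype
  induction k with
  | zero => exact inferInstanceAs (Finite (Set Γ))
  | succ k ih => exact inferInstanceAs (Finite (Set Γ × Set (PointType Γ k)))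

variable (R V Γ) in
/-- The type of a point of a model. -/
def pointType : (k : ℕ) → W → PointType Γ k
  | 0, w => {a : Γ | Forces R V w a}
  | k + 1, w => ({a : Γ | Forces R V w a}, {t | ∃ v, R w v ∧ pointType k v = t})

theorem pointType_succ_eq_iff {k : ℕ} {w : W} {t : PointType Γ (k + 1)} :
    pointType R V Γ (k + 1) w = t ↔
      {a : Γ | Forces R V w a} = t.1 ∧ {t | ∃ v, R w v ∧ pointType R V Γ k v = t} = t.2 :=
  Prod.ext_iff

theorem forces_iff_of_pointType_eq {k : ℕ} {w w' : W}
    (h : pointType R V Γ k w = pointType R V Γ k w') :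
    {a : Γ | Forces R V w a} = {a : Γ | Forces R V w' a} := by
  cases k with
  | zero => exact h
  | succ k => exact (Prod.ext_iff.1 h).1

/-- There are finitely many formulas in `Γ` and finitely many types one level down, so a finite
conjunction says which formulas hold and, through diamonds, which types occur at successors. -/
theorem definable_pointType (hΓ : Γ.Finite) (k : ℕ) (t : PointType Γ k) :
    Definable R V fun w => pointType R V Γ k w = t := by
  have := hΓ.to_subtype
  have h0 (s : Set Γ) : Definable R V fun w => {a : Γ | Forces R V w a} = s :=
    (Definable.forall_finite fun a : Γ =>
      Definable.iff_const ⟨a.1, fun w => Iff.rfl⟩ (a ∈ s)).congr fun w => by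
        simp [Set.ext_iff]
  induction k with
  | zero => exact h0 t
  | succ k ih =>
    have := finite_pointType hΓ k
    refine ((h0 t.1).and (Definable.forall_finite fun t' : PointType Γ k =>
      ((ih t').dia.iff_const (t' ∈ t.2)))).congr fun w => ?_
    rw [pointType_succ_eq_iff]
    exact and_congr_right' Set.ext_iff.symm

theorem exists_rel_of_pointType_succ_eq {k : ℕ} {w w' v : W}
    (h : pointType R V Γ (k + 1) w = pointType R V Γ (k + 1) w') (hv : R w v) :
    ∃ v', R w' v' ∧ pointType R V Γ k v' = pointType R V Γ k v :=
  (Set.ext_iff.1 (Prod.ext_iff.1 h).2 _).1 ⟨v, hv, rfl⟩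

/-- Below a point forcing `□ᵏ⊥` there is nothing left for a deeper type to detect: matched
successors force the next smaller `□ʲ⊥`, and induction refines their equality of types by one level.
-/
theorem pointType_succ_eq_of_eq {k : ℕ} {w w' : W} (hw : Forces R V w (boxBot k))
    (hw' : Forces R V w' (boxBot k)) (h : pointType R V Γ k w = pointType R V Γ k w') :
    pointType R V Γ (k + 1) w = pointType R V Γ (k + 1) w' := by
  induction k generalizing w w' with
  | zero => exact hw.elim
  | succ k ih =>
    refine pointType_succ_eq_iff.2 ⟨forces_iff_of_pointType_eq h, Set.ext fun t => ⟨?_, ?_⟩⟩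
    · rintro ⟨v, hv, rfl⟩
      obtain ⟨v', hv', e⟩ := exists_rel_of_pointType_succ_eq h hv
      exact ⟨v', hv', ih (hw' v' hv') (hw v hv) e⟩
    · rintro ⟨v, hv, rfl⟩
      obtain ⟨v', hv', e⟩ := exists_rel_of_pointType_succ_eq h.symm hv
      exact ⟨v', hv', ih (hw v' hv') (hw' v hv) e⟩

/-- Equality of types of height `n` matches successors only at height `n - 1`; the stabilization
under `□ⁿ⊥` restores height `n`, so the quotient map is a bisimulation there. -/
theorem exists_rel_of_pointType_eq {n : ℕ} {w w' v' : W} (hw : Forces R V w (boxBot n))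
    (hw' : Forces R V w' (boxBot n)) (h : pointType R V Γ n w = pointType R V Γ n w')
    (hv : R w' v') : ∃ v, R w v ∧ pointType R V Γ n v = pointType R V Γ n v' := by
  cases n with
  | zero => exact hw.elim
  | succ n =>
    obtain ⟨v, hwv, e⟩ := exists_rel_of_pointType_succ_eq h.symm hv
    exact ⟨v, hwv, pointType_succ_eq_of_eq (hw v hwv) (hw' v' hv) e⟩

end Filtration

end ModalFormula

namespace NormalLogic

/-- Finite models for a logic `L`: a formula outside `L` is refuted in a finite frame that validates
the theorems of `L` of the form `□ⁿ⊥ → θ` as well as `□ⁿ⊥`, if this is a theorem. -/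
theorem exists_finite_frame {L : NormalLogic} {a : ModalFormula} (ha : a ∉ L.carrier) (n : ℕ) :
    ∃ (H : Type) (_ : Finite H) (Q : H → H → Prop), ¬ Valid Q a ∧
      (∀ b, imp (boxBot n) b ∈ L.carrier → Valid Q (imp (boxBot n) b)) ∧
      (boxBot n ∈ L.carrier → Valid Q (boxBot n)) := by
  obtain ⟨W, R, V, hL, w₀, hw₀⟩ := exists_model ha
  -- The subformulas of `□ⁿ⊥` are included so that the quotient does not change which points force
  -- it.
  set Γ : Set ModalFormula := subformulas a ∪ subformulas (boxBot n) with hΓdef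
  have hΓ : Γ.Finite := (finite_subformulas a).union (finite_subformulas _)
  have := finite_pointType hΓ n
  let f : W → Set.range (pointType R V Γ n) := Set.rangeFactorization _
  have hf (w w' : W) : f w = f w' ↔ pointType R V Γ n w = pointType R V Γ n w' := Subtype.ext_iff
  have hfΓ : ∀ w w', f w = f w' → ∀ a ∈ Γ, (Forces R V w a ↔ Forces R V w' a) :=
    fun w w' h b hb => Set.ext_iff.1 (forces_iff_of_pointType_eq ((hf w w').1 h)) ⟨b, hb⟩
  have hnΓ : boxBot n ∈ Γ := Or.inr (mem_subformulas_self _)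
  have hn (U : ℕ → Set.range (pointType R V Γ n) → Prop) (w : W) :
      Forces (Relation.Map R f f) U (f w) (boxBot n) ↔ Forces R V w (boxBot n) :=
    (forces_boxBot_congr _ _ n _).trans (forces_filtration hfΓ Set.subset_union_right w)
  refine ⟨Set.range (pointType R V Γ n), inferInstance, Relation.Map R f f,
    fun h => hw₀ ((forces_filtration hfΓ Set.subset_union_left w₀).1 (h _ _)), ?_, ?_⟩
  · rintro b hb U ⟨_, w, rfl⟩ hw
    have hw : Forces R V w (boxBot n) := (hn U w).1 hw
    -- The pullback of any valuation of the quotient is a finite union of definable fibres. The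
    -- defining formulas form a substitution, under which theorems of `L` remain true in the model.
    have hσ : ∀ k, Definable R V fun w => U k (f w) := fun k =>
      (Definable.exists_finite fun h : Set.range (pointType R V Γ n) =>
        (definable_pointType hΓ n h.1).and
          (Q := fun _ => U k h) ((Definable.iff_const (P := fun _ => True)
            ⟨imp bot bot, fun _ => by simp [Forces]⟩ (U k h)).congr fun _ => by simp)).congr
        fun w => ⟨fun ⟨h, e, hU⟩ => by rwa [show f w = h from Subtype.ext e],
          fun h => ⟨f w, rfl, h⟩⟩
    choose σ hσ using hσ
    refine (forces_map_iff_subst (fun w w' v' hw h hv => ?_) hσ b hw).2 ?_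
    · obtain ⟨v, hv, e⟩ := exists_rel_of_pointType_eq hw ((hfΓ w w' h _ hnΓ).1 hw)
        ((hf w w').1 h) hv
      exact ⟨v, hv, (hf _ _).2 e⟩
    -- As `□ⁿ⊥` has no variables, its substitution instance still holds at `w`.
    · have := hL _ (L.subst_mem σ _ hb) w
      refine this ?_
      rw [forces_subst]
      exact (forces_boxBot_congr _ _ n _).1 hw
  · rintro h U ⟨_, w, rfl⟩
    exact (hn U w).2 (hL _ h w)

end NormalLogic

/-! ### Splittings and separating finite frames -/

namespace NormalLogic

/-- The least logic containing a set of formulas. -/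
def generate (A : Set ModalFormula) : NormalLogic :=
  sInf {L | A ⊆ L.carrier}

theorem subset_generate (A : Set ModalFormula) : A ⊆ (generate A).carrier :=
  fun _ ha _ hL => hL ha

theorem generate_le {A : Set ModalFormula} {L : NormalLogic} (h : A ⊆ L.carrier) :
    generate A ≤ L :=
  sInf_le h

/-- The union of an increasing sequence of logics. -/
def iUnion (T : ℕ → NormalLogic) (hT : Monotone T) : NormalLogic where
  carrier := {a | ∃ n, a ∈ (T n).carrier}
  ax_weak a b := ⟨0, (T 0).ax_weak a b⟩
  ax_distr a b c := ⟨0, (T 0).ax_distr a b c⟩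
  ax_dne a := ⟨0, (T 0).ax_dne a⟩
  ax_box a b := ⟨0, (T 0).ax_box a b⟩
  mp a b := fun ⟨m, hm⟩ ⟨n, hn⟩ => ⟨max m n, (T _).mp a b (hT (le_max_left m n) hm)
    (hT (le_max_right m n) hn)⟩
  nec a := fun ⟨n, hn⟩ => ⟨n, (T n).nec a hn⟩
  subst_mem σ a := fun ⟨n, hn⟩ => ⟨n, (T n).subst_mem σ a hn⟩

theorem imp_mem_weaken {L : NormalLogic} {a b : ModalFormula} (h : b ∈ L.carrier) :
    imp a b ∈ L.carrier :=
  L.mp _ _ (L.ax_weak b a) h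

/-- The companion of a splitting contains some `□ⁿ⊥`. -/
theorem exists_boxBot_mem_of_isSplittingPair {x y : NormalLogic} (h : IsSplittingPair x y) :
    ∃ n, boxBot n ∈ y.carrier := by
  by_contra! hn
  -- It suffices that `x ≤ K`: a theorem of `x` outside `K` is missing from some `K + □ⁿ⊥`, which
  -- then must lie below `y`.
  refine h.1 (le_trans (fun a ha => by_contra fun haK => ?_) (bot_le : K ≤ y))
  obtain ⟨n, hna⟩ := exists_notMem_K_add_boxBot haK
  rcases h.2 (K.add (boxBot n)) with hz | hz
  · exact hna (hz ha)
  · exact hn n (K_add_le_iff.1 hz)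

/-- A splitting is axiomatized by a single formula of the form `□ⁿ⊥ → θ`. -/
theorem exists_eq_K_add_of_isSplitting {x : NormalLogic} (h : IsSplitting x) :
    ∃ n a, x = K.add (imp (boxBot n) a) := by
  obtain ⟨y, hxy⟩ := h
  obtain ⟨n, hn⟩ := exists_boxBot_mem_of_isSplittingPair hxy
  obtain ⟨a, hax, hay⟩ := Set.not_subset.1 hxy.1
  refine ⟨n, a, le_antisymm ?_ (K_add_le_iff.2 (imp_mem_weaken hax))⟩
  -- `K + (□ⁿ⊥ → a)` is not below `y`, since with `□ⁿ⊥ ∈ y` that would put `a` into `y`.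
  exact (hxy.2 _).resolve_right fun hle => hay (y.mp _ _ (K_add_le_iff.1 hle) hn)

/-- The splittings are axiomatized by formulas `□ᵐ⊥ → b`. Since `φ` is a single formula, those with
`m` up to some fixed `n` already yield it, and filtration at height `n` preserves them. -/
theorem exists_finite_frame_of_notMem {φ ψ : ModalFormula} (h : IsUnionSplitting (K.add φ))
    (hψ : ψ ∉ (K.add φ).carrier) :
    ∃ (H : Type) (_ : Finite H) (Q : H → H → Prop), Valid Q φ ∧ ¬ Valid Q ψ := by
  obtain ⟨S, hS, hsup⟩ := h
  let T (n : ℕ) : NormalLogic :=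
    generate {a | ∃ m ≤ n, ∃ b, a = imp (boxBot m) b ∧ a ∈ (K.add φ).carrier}
  have hT : Monotone T := fun m n hmn =>
    generate_le fun a ⟨k, hk, b, hb⟩ => subset_generate _ ⟨k, hk.trans hmn, b, hb⟩
  have hle : K.add φ ≤ iUnion T hT := by
    rw [hsup]
    refine sSup_le fun s hs => ?_
    obtain ⟨n, a, rfl⟩ := exists_eq_K_add_of_isSplitting (hS s hs)
    refine K_add_le_iff.2 ⟨n, subset_generate _ ⟨n, le_rfl, a, rfl, K_add_le_iff.1 ?_⟩⟩
    rw [hsup]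
    exact le_sSup hs
  obtain ⟨n, hn⟩ := K_add_le_iff.1 hle
  obtain ⟨H, hH, Q, hQψ, hQ, -⟩ := exists_finite_frame hψ n
  refine ⟨H, hH, Q, ?_, hQψ⟩
  have hTQ : T n ≤ ofFrame Q := by
    refine generate_le ?_
    rintro a ⟨m, hm, b, rfl, ha⟩ V w hw
    -- Only theorems with antecedent `□ⁿ⊥` are known to be preserved, so `□ᵐ⊥ → b` is weakened to
    -- `□ⁿ⊥ → (□ᵐ⊥ → b)`.
    exact hQ _ (imp_mem_weaken ha) V w (forces_boxBot_mono hm hw) hw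
  exact hTQ hn

/-- Some splitting `s` of the join is not below `K + ψ`, so `ψ` belongs to its companion `y`.
Because `y` contains some `□ⁿ⊥`, the filtered frame validates all of `y`, while it refutes a theorem
of `s`. -/
theorem exists_finite_frame_of_notMem_add {φ ψ : ModalFormula} (h : IsUnionSplitting (K.add φ))
    (hφ : φ ∉ (K.add ψ).carrier) :
    ∃ (H : Type) (_ : Finite H) (Q : H → H → Prop), Valid Q ψ ∧ ¬ Valid Q φ := by
  obtain ⟨S, hS, hsup⟩ := h
  obtain ⟨s, hs, hsψ⟩ : ∃ s ∈ S, ¬ s ≤ K.add ψ := by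
    by_contra! hall
    exact hφ (K_add_le_iff.1 (hsup.le.trans (sSup_le hall)))
  obtain ⟨y, hsy⟩ := hS s hs
  obtain ⟨n, hn⟩ := exists_boxBot_mem_of_isSplittingPair hsy
  obtain ⟨a, has, hay⟩ := Set.not_subset.1 hsy.1
  obtain ⟨H, hH, Q, hQa, hQ, hQn⟩ := exists_finite_frame hay n
  refine ⟨H, hH, Q, fun V w => ?_, fun hQφ => hQa ?_⟩
  · have hψ : ψ ∈ y.carrier := K_add_le_iff.1 ((hsy.2 _).resolve_left hsψ)
    exact hQ ψ (imp_mem_weaken hψ) V w (hQn hn V w)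
  · have hle : K.add φ ≤ ofFrame Q := K_add_le_iff.2 hQφ
    exact ((hsup ▸ le_sSup hs : s ≤ K.add φ).trans hle) has

/-- The axiomatization problem for a union-splitting in terms of finite frames. -/
theorem exists_finite_frame_of_not_axiomatizationProblem {φ ψ : ModalFormula}
    (h : IsUnionSplitting (K.add φ)) (hne : ¬ AxiomatizationProblem K φ ψ) :
    ∃ (H : Type) (_ : Finite H) (Q : H → H → Prop), ¬ (Valid Q φ ↔ Valid Q ψ) := by
  by_cases hψ : ψ ∈ (K.add φ).carrier
  · have hφ : φ ∉ (K.add ψ).carrier := fun hφ =>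
      hne (le_antisymm (K_add_le_iff.2 hψ) (K_add_le_iff.2 hφ))
    obtain ⟨H, hH, Q, h1, h2⟩ := exists_finite_frame_of_notMem_add h hφ
    exact ⟨H, hH, Q, by tauto⟩
  · obtain ⟨H, hH, Q, h1, h2⟩ := exists_finite_frame_of_notMem h hψ
    exact ⟨H, hH, Q, by tauto⟩

end NormalLogic

/-! ### Primitive recursive model checking in finite frames -/

namespace ModalFormula

section Constructors

open Primrec

theorem primrec_box : Primrec box :=
  encode_iff.1 <| (nat_add.comp (nat_mul.comp (const 3) Primrec.encode) (const 2)).of_eq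
    fun _ => rfl

theorem primrec_imp : Primrec₂ imp :=
  Primrec₂.encode_iff.1 <| (nat_add.comp (nat_mul.comp (const 3)
    (Primrec₂.natPair.comp (Primrec.encode.comp fst) (Primrec.encode.comp snd)))
      (const 3)).of_eq fun _ => rfl

variable {α σ : Type*} [Primcodable α] [Primcodable σ]

/-- Structural recursion on formulas is primitive recursive. -/
theorem primrec_of_structural {f : α → ModalFormula → σ} {b : α → σ} {v : α → ℕ → σ}
    {x : α → σ → σ} {i : α → σ × σ → σ} (hb : Primrec b) (hv : Primrec₂ v) (hx : Primrec₂ x)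
    (hi : Primrec₂ i) (f_bot : ∀ p, f p bot = b p) (f_var : ∀ p n, f p (var n) = v p n)
    (f_box : ∀ p a, f p (box a) = x p (f p a))
    (f_imp : ∀ p a c, f p (imp a c) = i p (f p a, f p c)) : Primrec₂ f := by
  -- Course-of-values recursion on codes: `l` holds the values at all smaller codes, so its length
  -- is the code being evaluated, and the tests modulo 3 follow `decodeFormula`.
  let g (p : α) (l : List σ) : Option σ :=
    if l.length = 0 then some (b p)
    else if (l.length - 1) % 3 = 0 then some (v p ((l.length - 1) / 3))
    else if (l.length - 1) % 3 = 1 then l[(l.length - 1) / 3]?.map (x p)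
    else l[((l.length - 1) / 3).unpair.1]?.bind fun s =>
      l[((l.length - 1) / 3).unpair.2]?.map fun t => i p (s, t)
  have hlen : Primrec fun q : α × List σ => q.2.length := list_length.comp snd
  have hpred : Primrec fun q : α × List σ => q.2.length - 1 := nat_sub.comp hlen (const 1)
  have hdiv : Primrec fun q : α × List σ => (q.2.length - 1) / 3 := nat_div.comp hpred (const 3)
  have hmod : Primrec fun q : α × List σ => (q.2.length - 1) % 3 := nat_mod.comp hpred (const 3)
  have hg : Primrec₂ g := by
    refine Primrec.ite (Primrec.eq.comp hlen (const 0)) (option_some.comp (hb.comp fst)) ?_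
    refine Primrec.ite (Primrec.eq.comp hmod (const 0)) (option_some.comp (hv.comp fst hdiv)) ?_
    refine Primrec.ite (Primrec.eq.comp hmod (const 1)) ?_ ?_
    · exact option_map (list_getElem?.comp snd hdiv) (hx.comp (fst.comp fst) snd).to₂
    · refine option_bind (list_getElem?.comp snd (fst.comp (unpair.comp hdiv))) ?_
      have hi' : Primrec₂ fun (q : (α × List σ) × σ) (t : σ) => i q.1.1 (q.2, t) :=
        hi.comp (fst.comp (fst.comp fst)) (Primrec.pair (snd.comp fst) snd)
      exact (option_map (list_getElem?.comp (snd.comp fst)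
        (snd.comp (unpair.comp (hdiv.comp fst)))) hi').to₂
  have hdec : Primrec₂ fun p n => f p (decodeFormula n) := by
    refine nat_strong_rec _ hg fun p n => ?_
    cases n with
    | zero => simp [g, decodeFormula, f_bot]
    | succ n =>
      have h0 : n / 3 < n + 1 := Nat.lt_succ_of_le (Nat.div_le_self n 3)
      have h1 : (n / 3).unpair.1 < n + 1 := lt_of_le_of_lt (Nat.unpair_left_le _) h0
      have h2 : (n / 3).unpair.2 < n + 1 := lt_of_le_of_lt (Nat.unpair_right_le _) h0
      rw [decodeFormula]
      simp only [g, List.length_map, List.length_range, Nat.add_sub_cancel]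
      rw [if_neg (Nat.succ_ne_zero n)]
      split_ifs
      · rw [f_var]
      · simp [f_box, h0]
      · simp [f_imp, h1, h2]
  exact (hdec.comp fst (Primrec.encode.comp snd)).of_eq fun q =>
    congrArg (f q.1) (decode_encodeFormula q.2)

end Constructors

theorem primrecRel_mem {α : Type*} [Primcodable α] :
    PrimrecRel fun (l : List α) (a : α) => a ∈ l :=
  (PrimrecRel.exists_mem_list (R := fun a b : α => a = b) Primrec.eq).of_eq fun l b => by simp

theorem _root_.PrimrecPred.imp {α : Type*} [Primcodable α] {p q : α → Prop} (hp : PrimrecPred p)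
    (hq : PrimrecPred q) : PrimrecPred fun a => p a → q a :=
  (hp.not.or hq).of_eq fun _ => imp_iff_not_or.symm

theorem _root_.PrimrecPred.iff {α : Type*} [Primcodable α] {p q : α → Prop} (hp : PrimrecPred p)
    (hq : PrimrecPred q) : PrimrecPred fun a => p a ↔ q a :=
  ((hp.imp hq).and (hq.imp hp)).of_eq fun _ => iff_def.symm

/-- The list of points below `n` at which a formula is true, in the model in which `i` sees `j` if
`r` contains the pair `(i, j)`, and the variable `k` is true at `i` if `v` contains `(k, i)`. -/
def truthSet (n : ℕ) (r v : List ℕ) : ModalFormula → List ℕ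
  | bot => []
  | var k => (List.range n).filter fun i => Nat.pair k i ∈ v
  | box a => (List.range n).filter fun i =>
      ∀ j ∈ List.range n, Nat.pair i j ∈ r → j ∈ truthSet n r v a
  | imp a b => (List.range n).filter fun i => i ∈ truthSet n r v a → i ∈ truthSet n r v b

theorem primrec_truthSet :
    Primrec₂ fun (p : ℕ × List ℕ × List ℕ) a => truthSet p.1 p.2.1 p.2.2 a := by
  refine primrec_of_structural (b := fun _ => [])
    (v := fun p k => (List.range p.1).filter fun i => Nat.pair k i ∈ p.2.2)
    (x := fun p t => (List.range p.1).filter fun i =>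
      ∀ j ∈ List.range p.1, Nat.pair i j ∈ p.2.1 → j ∈ t)
    (i := fun p t => (List.range p.1).filter fun i => i ∈ t.1 → i ∈ t.2)
    (.const []) ?_ ?_ ?_ (fun _ => rfl) (fun _ _ => rfl) (fun _ _ => rfl) (fun _ _ _ => rfl)
  · have h : PrimrecRel fun (i : ℕ) (q : (ℕ × List ℕ × List ℕ) × ℕ) =>
        Nat.pair q.2 i ∈ q.1.2.2 :=
      primrecRel_mem.comp (Primrec.snd.comp (Primrec.snd.comp (Primrec.fst.comp Primrec.snd)))
        (Primrec₂.natPair.comp (Primrec.snd.comp Primrec.snd) Primrec.fst)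
    exact h.listFilter.comp (Primrec.list_range.comp (Primrec.fst.comp Primrec.fst)) Primrec.id
  · have h : PrimrecRel fun (j : ℕ) (q : ℕ × (ℕ × List ℕ × List ℕ) × List ℕ) =>
        Nat.pair q.1 j ∈ q.2.1.2.1 → j ∈ q.2.2 :=
      PrimrecPred.imp (primrecRel_mem.comp (Primrec.fst.comp (Primrec.snd.comp (Primrec.fst.comp
          (Primrec.snd.comp Primrec.snd))))
        (Primrec₂.natPair.comp (Primrec.fst.comp Primrec.snd) Primrec.fst))
        (primrecRel_mem.comp (Primrec.snd.comp (Primrec.snd.comp Primrec.snd)) Primrec.fst)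
    have h' : PrimrecRel fun (i : ℕ) (q : (ℕ × List ℕ × List ℕ) × List ℕ) =>
        ∀ j ∈ List.range q.1.1, Nat.pair i j ∈ q.1.2.1 → j ∈ q.2 :=
      h.forall_mem_list.comp (Primrec.list_range.comp (Primrec.fst.comp (Primrec.fst.comp
        Primrec.snd))) Primrec.id
    exact h'.listFilter.comp (Primrec.list_range.comp (Primrec.fst.comp Primrec.fst)) Primrec.id
  · have h : PrimrecRel fun (i : ℕ) (q : (ℕ × List ℕ × List ℕ) × List ℕ × List ℕ) =>
        i ∈ q.2.1 → i ∈ q.2.2 :=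
      PrimrecPred.imp (primrecRel_mem.comp (Primrec.fst.comp (Primrec.snd.comp Primrec.snd))
        Primrec.fst) (primrecRel_mem.comp (Primrec.snd.comp (Primrec.snd.comp Primrec.snd))
        Primrec.fst)
    exact h.listFilter.comp (Primrec.list_range.comp (Primrec.fst.comp Primrec.fst)) Primrec.id

/-- The accessibility relation on `Fin n` coded by a list of pairs. -/
def codeRel (n : ℕ) (r : List ℕ) (i j : Fin n) : Prop :=
  Nat.pair i j ∈ r

theorem mem_truthSet {n : ℕ} {r v : List ℕ} (a : ModalFormula) (i : Fin n) :
    (i : ℕ) ∈ truthSet n r v a ↔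
      Forces (codeRel n r) (fun k (j : Fin n) => Nat.pair k j ∈ v) i a := by
  induction a generalizing i with
  | bot => simp [truthSet, Forces]
  | var k => simp [truthSet, Forces]
  | box a ih =>
    simp only [truthSet, Forces, ← ih]
    simp [Fin.forall_iff, codeRel]
  | imp a b iha ihb =>
    simp only [truthSet, Forces, ← iha, ← ihb]
    simp [imp_iff_not_or]

/-- Lists representing all subsets of `{0, …, m - 1}`. -/
def subsetLists (m : ℕ) : List (List ℕ) :=
  Nat.rec [[]] (fun k s => s ++ s.map (List.cons k)) m

theorem primrec_subsetLists : Primrec subsetLists :=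
  Primrec.nat_rec₁ [[]] (Primrec.list_append.comp Primrec.snd (Primrec.list_map Primrec.snd
    (Primrec.list_cons.comp (Primrec.fst.comp Primrec.fst) Primrec.snd).to₂)).to₂

theorem exists_mem_subsetLists (P : ℕ → Prop) (m : ℕ) :
    ∃ v ∈ subsetLists m, ∀ j, j ∈ v ↔ j < m ∧ P j := by
  induction m with
  | zero => exact ⟨[], by simp [subsetLists], by simp⟩
  | succ m ih =>
    obtain ⟨v, hv, h⟩ := ih
    by_cases hm : P m
    · refine ⟨m :: v, List.mem_append_right _ (List.mem_map_of_mem hv), fun j => ?_⟩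
      rw [List.mem_cons, h, Nat.lt_succ_iff_lt_or_eq]
      constructor
      · rintro (rfl | h)
        exacts [⟨Or.inr rfl, hm⟩, ⟨Or.inl h.1, h.2⟩]
      · rintro ⟨h | rfl, hP⟩
        exacts [Or.inr ⟨h, hP⟩, Or.inl rfl]
    · refine ⟨v, List.mem_append_left _ hv, fun j => (h j).trans ?_⟩
      rw [Nat.lt_succ_iff_lt_or_eq]
      refine ⟨fun h => ⟨Or.inl h.1, h.2⟩, ?_⟩
      rintro ⟨h | rfl, hP⟩
      exacts [⟨h, hP⟩, absurd hP hm]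

/-- Validity in the frame with `n` points coded by `r`, as a bounded statement. -/
def CodeValid (n : ℕ) (r : List ℕ) (a : ModalFormula) : Prop :=
  ∀ v ∈ subsetLists (Nat.pair (encodeFormula a + n) (encodeFormula a + n)),
    ∀ i ∈ List.range n, i ∈ truthSet n r v a

theorem primrecPred_codeValid :
    PrimrecPred fun p : (ℕ × List ℕ) × ModalFormula => CodeValid p.1.1 p.1.2 p.2 := by
  have h : PrimrecRel fun (i : ℕ) (q : List ℕ × (ℕ × List ℕ) × ModalFormula) =>
      i ∈ truthSet q.2.1.1 q.2.1.2 q.1 q.2.2 :=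
    primrecRel_mem.comp (primrec_truthSet.comp (Primrec.pair
      (Primrec.fst.comp (Primrec.fst.comp (Primrec.snd.comp Primrec.snd))) (Primrec.pair
      (Primrec.snd.comp (Primrec.fst.comp (Primrec.snd.comp Primrec.snd)))
      (Primrec.fst.comp Primrec.snd))) (Primrec.snd.comp (Primrec.snd.comp Primrec.snd)))
      Primrec.fst
  have h' : PrimrecRel fun (v : List ℕ) (q : (ℕ × List ℕ) × ModalFormula) =>
      ∀ i ∈ List.range q.1.1, i ∈ truthSet q.1.1 q.1.2 v q.2 :=
    h.forall_mem_list.comp (Primrec.list_range.comp (Primrec.fst.comp (Primrec.fst.comp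
      Primrec.snd))) Primrec.id
  have hs : Primrec fun q : (ℕ × List ℕ) × ModalFormula => encodeFormula q.2 + q.1.1 :=
    Primrec.nat_add.comp (Primrec.encode.comp Primrec.snd) (Primrec.fst.comp Primrec.fst)
  exact h'.forall_mem_list.comp (primrec_subsetLists.comp (Primrec₂.natPair.comp hs hs)) Primrec.id

/-- The code of a formula bounds the indices of its variables. -/
theorem forces_congr_of_le {W : Type*} {R : W → W → Prop} {V V' : ℕ → W → Prop}
    {a : ModalFormula} (h : ∀ k ≤ encodeFormula a, ∀ w, V k w ↔ V' k w) (w : W) :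
    Forces R V w a ↔ Forces R V' w a := by
  induction a generalizing w with
  | bot => rfl
  | var n => exact h n (by simp [encodeFormula]; omega) w
  | box a ih =>
    exact forall₂_congr fun v _ => ih (fun k hk => h k (by simp [encodeFormula]; omega)) v
  | imp a b iha ihb =>
    have h1 := Nat.left_le_pair (encodeFormula a) (encodeFormula b)
    have h2 := Nat.right_le_pair (encodeFormula a) (encodeFormula b)
    exact imp_congr (iha (fun k hk => h k (by simp [encodeFormula]; omega)) w)
      (ihb (fun k hk => h k (by simp [encodeFormula]; omega)) w)

theorem pair_lt_pair {a b c d : ℕ} (h : a ≤ c) (k : b < d) : Nat.pair a b < Nat.pair c d := by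
  refine lt_of_lt_of_le (Nat.pair_lt_pair_right a k) ?_
  rcases h.lt_or_eq with h | rfl
  · exact (Nat.pair_lt_pair_left d h).le
  · rfl

theorem codeValid_iff {n : ℕ} {r : List ℕ} {a : ModalFormula} :
    CodeValid n r a ↔ Valid (codeRel n r) a := by
  refine ⟨fun h V i => ?_, fun h v _ i hi => ?_⟩
  · obtain ⟨v, hv, hmem⟩ := exists_mem_subsetLists
      (fun m => ∃ j : Fin n, (j : ℕ) = m.unpair.2 ∧ V m.unpair.1 j)
      (Nat.pair (encodeFormula a + n) (encodeFormula a + n))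
    have hi := (mem_truthSet a i).1 (h v hv i (List.mem_range.2 i.2))
    refine (forces_congr_of_le (fun k hk j => ?_) i).1 hi
    -- With `k` at most the code of `a` and `j < n`, the pair `(k, j)` is below the bound in
    -- `CodeValid`, so the listed valuations agree with `V` wherever it matters.
    rw [hmem, and_iff_right (pair_lt_pair (by omega) (by omega))]
    simp [Fin.val_inj]
  · exact (mem_truthSet a ⟨i, List.mem_range.1 hi⟩).2 (h _ _)

theorem forces_equiv {W W' : Type*} {R : W → W → Prop} {R' : W' → W' → Prop} (e : W ≃ W')
    (he : ∀ w v, R w v ↔ R' (e w) (e v)) (V : ℕ → W' → Prop) (a : ModalFormula) (w : W) :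
    Forces R (fun k w => V k (e w)) w a ↔ Forces R' V (e w) a := by
  induction a generalizing w with
  | bot => rfl
  | var n => rfl
  | box a ih =>
    refine ⟨fun h v hv => ?_, fun h v hv => (ih v).2 (h _ ((he w v).1 hv))⟩
    obtain ⟨v, rfl⟩ := e.surjective v
    exact (ih v).1 (h v ((he w v).2 hv))
  | imp a b iha ihb => exact imp_congr (iha w) (ihb w)

theorem valid_equiv {W W' : Type*} {R : W → W → Prop} {R' : W' → W' → Prop} (e : W ≃ W')
    (he : ∀ w v, R w v ↔ R' (e w) (e v)) (a : ModalFormula) : Valid R a ↔ Valid R' a := by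
  refine ⟨fun h V w => ?_, fun h V w => ?_⟩
  · obtain ⟨w, rfl⟩ := e.surjective w
    exact (forces_equiv e he V a w).1 (h _ _)
  · have := (forces_equiv e he (fun k w => V k (e.symm w)) a w).2 (h _ _)
    simpa using this

theorem exists_code_of_finite {H : Type*} [Finite H] (Q : H → H → Prop) :
    ∃ n r, ∀ a, CodeValid n r a ↔ Valid Q a := by
  obtain ⟨n, ⟨e⟩⟩ := Finite.exists_equiv_fin H
  obtain ⟨r, -, hr⟩ := exists_mem_subsetLists (fun m => ∃ i j : Fin n,
    m = Nat.pair i j ∧ Q (e.symm i) (e.symm j)) (Nat.pair n n)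
  refine ⟨n, r, fun a => codeValid_iff.trans (valid_equiv e (fun w v => ?_) a).symm⟩
  rw [codeRel, hr, and_iff_right (pair_lt_pair (by omega) (by omega))]
  simp [Nat.pair_eq_pair, Fin.val_inj]

end ModalFormula

/-! ### Coded derivations -/

namespace ModalFormula

/-- Derivability in `K + φ`, with `φ` used only through its substitution instances. -/
inductive Derivable (φ : ModalFormula) : ModalFormula → Prop
  | weak (a b) : Derivable φ (imp a (imp b a))
  | distr (a b c) : Derivable φ (imp (imp a (imp b c)) (imp (imp a b) (imp a c)))
  | dne (a) : Derivable φ (imp (imp (imp a bot) bot) a)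
  | boxDistr (a b) : Derivable φ (imp (box (imp a b)) (imp (box a) (box b)))
  | mp {a b} : Derivable φ (imp a b) → Derivable φ a → Derivable φ b
  | nec {a} : Derivable φ a → Derivable φ (box a)
  | inst (σ) : Derivable φ (φ.subst σ)

theorem Derivable.subst {φ a : ModalFormula} (h : Derivable φ a) (σ : ℕ → ModalFormula) :
    Derivable φ (a.subst σ) := by
  induction h with
  | weak a b => exact .weak _ _
  | distr a b c => exact .distr _ _ _
  | dne a => exact .dne _
  | boxDistr a b => exact .boxDistr _ _
  | mp _ _ ih₁ ih₂ => exact .mp ih₁ ih₂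
  | nec _ ih => exact .nec ih
  | inst τ => exact subst_subst τ σ φ ▸ .inst _

/-- Substitution can be pushed to the leaves of a derivation, so the derivable formulas form a
normal logic containing `φ`. -/
theorem derivable_of_mem_K_add {φ a : ModalFormula} (h : a ∈ (NormalLogic.K.add φ).carrier) :
    Derivable φ a := by
  let L : NormalLogic :=
    { carrier := {a | Derivable φ a}
      ax_weak := .weak
      ax_distr := .distr
      ax_dne := .dne
      ax_box := .boxDistr
      mp := fun _ _ => .mp
      nec := fun _ => .nec
      subst_mem := fun σ _ h => h.subst σ }
  have hφ : φ ∈ L.carrier := by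
    have := Derivable.inst (φ := φ) var
    rwa [subst_var] at this
  exact (NormalLogic.K_add_le_iff.2 hφ : NormalLogic.K.add φ ≤ L) h

/-- The finite substitution given by a list. -/
def listSubst (s : List ModalFormula) (a : ModalFormula) : ModalFormula :=
  a.subst fun n => s.getD n bot

theorem primrec_listSubst : Primrec₂ listSubst :=
  primrec_of_structural (.const bot) (Primrec.list_getD bot) (primrec_box.comp Primrec.snd).to₂
    (primrec_imp.comp (Primrec.fst.comp Primrec.snd) (Primrec.snd.comp Primrec.snd)).to₂
    (fun _ => rfl) (fun _ _ => rfl) (fun _ _ => rfl) (fun _ _ _ => rfl)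

theorem subst_congr_of_le {σ τ : ℕ → ModalFormula} {a : ModalFormula}
    (h : ∀ k ≤ encodeFormula a, σ k = τ k) : a.subst σ = a.subst τ := by
  induction a with
  | bot => rfl
  | var n => exact h n (by simp [encodeFormula]; omega)
  | box a ih => exact congrArg box (ih fun k hk => h k (by simp [encodeFormula]; omega))
  | imp a b iha ihb =>
    have h1 := Nat.left_le_pair (encodeFormula a) (encodeFormula b)
    have h2 := Nat.right_le_pair (encodeFormula a) (encodeFormula b)
    exact congrArg₂ imp (iha fun k hk => h k (by simp [encodeFormula]; omega))
      (ihb fun k hk => h k (by simp [encodeFormula]; omega))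

theorem exists_listSubst_eq (σ : ℕ → ModalFormula) (a : ModalFormula) :
    ∃ s, listSubst s a = a.subst σ := by
  -- A list this long covers every variable of `a`, so the default value `bot` is never used.
  refine ⟨(List.range (encodeFormula a + 1)).map σ, subst_congr_of_le fun k hk => ?_⟩
  simp [List.getD, Nat.lt_succ_of_le hk]

instance : DecidableEq ModalFormula := Encodable.decidableEqOfEncodable _

/-- An instruction in a coded derivation: the number of a rule and its parameters. -/
abbrev Instruction : Type :=
  ℕ × (ModalFormula × ModalFormula × ModalFormula) × List ModalFormula

/-- Extend a list of formulas derived from `φ` by carrying out an instruction. -/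
def derivationStep (φ : ModalFormula) (i : Instruction) (S : List ModalFormula) :
    List ModalFormula :=
  if i.1 = 0 then imp i.2.1.1 (imp i.2.1.2.1 i.2.1.1) :: S
  else if i.1 = 1 then imp (imp i.2.1.1 (imp i.2.1.2.1 i.2.1.2.2))
    (imp (imp i.2.1.1 i.2.1.2.1) (imp i.2.1.1 i.2.1.2.2)) :: S
  else if i.1 = 2 then imp (imp (imp i.2.1.1 bot) bot) i.2.1.1 :: S
  else if i.1 = 3 then
    imp (box (imp i.2.1.1 i.2.1.2.1)) (imp (box i.2.1.1) (box i.2.1.2.1)) :: S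
  else if i.1 = 4 then
    if imp i.2.1.1 i.2.1.2.1 ∈ S ∧ i.2.1.1 ∈ S then i.2.1.2.1 :: S else S
  else if i.1 = 5 then if i.2.1.1 ∈ S then box i.2.1.1 :: S else S
  else listSubst i.2.2 φ :: S

/-- The formulas derived from `φ` by a list of instructions, the last one being carried out
first. -/
def derive (φ : ModalFormula) (l : List Instruction) : List ModalFormula :=
  l.foldr (derivationStep φ) []

theorem primrec_derive : Primrec₂ derive := by
  let C := (ModalFormula × List Instruction) × Instruction × List ModalFormula
  have hk : Primrec fun c : C => c.2.1.1 := Primrec.fst.comp (Primrec.fst.comp Primrec.snd)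
  have habc : Primrec fun c : C => c.2.1.2.1 :=
    Primrec.fst.comp (Primrec.snd.comp (Primrec.fst.comp Primrec.snd))
  have ha : Primrec fun c : C => c.2.1.2.1.1 := Primrec.fst.comp habc
  have hb : Primrec fun c : C => c.2.1.2.1.2.1 := Primrec.fst.comp (Primrec.snd.comp habc)
  have hc : Primrec fun c : C => c.2.1.2.1.2.2 := Primrec.snd.comp (Primrec.snd.comp habc)
  have hs : Primrec fun c : C => c.2.1.2.2 :=
    Primrec.snd.comp (Primrec.snd.comp (Primrec.fst.comp Primrec.snd))
  have hS : Primrec fun c : C => c.2.2 := Primrec.snd.comp Primrec.snd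
  have hφ : Primrec fun c : C => c.1.1 := Primrec.fst.comp Primrec.fst
  have hbot : Primrec fun _ : C => bot := Primrec.const bot
  have imp' {f g : C → ModalFormula} (hf : Primrec f) (hg : Primrec g) :
      Primrec fun c => imp (f c) (g c) := primrec_imp.comp hf hg
  have box' {f : C → ModalFormula} (hf : Primrec f) : Primrec fun c => box (f c) :=
    primrec_box.comp hf
  have cons' {f : C → ModalFormula} (hf : Primrec f) : Primrec fun c => f c :: c.2.2 :=
    Primrec.list_cons.comp hf hS
  have mem' {f : C → ModalFormula} (hf : Primrec f) : PrimrecPred fun c => f c ∈ c.2.2 :=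
    primrecRel_mem.comp hS hf
  have eq' (n : ℕ) : PrimrecPred fun c : C => c.2.1.1 = n := Primrec.eq.comp hk (.const n)
  have hstep : Primrec fun c : C => derivationStep c.1.1 c.2.1 c.2.2 :=
    .ite (eq' 0) (cons' (imp' ha (imp' hb ha))) <|
    .ite (eq' 1) (cons' (imp' (imp' ha (imp' hb hc)) (imp' (imp' ha hb) (imp' ha hc)))) <|
    .ite (eq' 2) (cons' (imp' (imp' (imp' ha hbot) hbot) ha)) <|
    .ite (eq' 3) (cons' (imp' (box' (imp' ha hb)) (imp' (box' ha) (box' hb)))) <|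
    .ite (eq' 4) (.ite ((mem' (imp' ha hb)).and (mem' ha)) (cons' hb) hS) <|
    .ite (eq' 5) (.ite (mem' ha) (cons' (box' ha)) hS) <|
    cons' (primrec_listSubst.comp hs hφ)
  exact Primrec.list_foldr Primrec.snd (.const []) hstep.to₂

theorem mem_K_add_of_mem_derive {φ a : ModalFormula} {l : List Instruction}
    (h : a ∈ derive φ l) : a ∈ (NormalLogic.K.add φ).carrier := by
  set L := NormalLogic.K.add φ with hL
  induction l generalizing a with
  | nil => simp [derive] at h
  | cons i l ih =>
    change a ∈ derivationStep φ i (derive φ l) at h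
    unfold derivationStep at h
    have cons {b : ModalFormula} (hb : b ∈ L.carrier) (h : a ∈ b :: derive φ l) :
        a ∈ L.carrier := by
      rcases List.mem_cons.1 h with rfl | h
      exacts [hb, ih h]
    split_ifs at h with _ _ _ _ _ h4 _ h5
    · exact cons (L.ax_weak _ _) h
    · exact cons (L.ax_distr _ _ _) h
    · exact cons (L.ax_dne _) h
    · exact cons (L.ax_box _ _) h
    · exact cons (L.mp _ _ (ih h4.1) (ih h4.2)) h
    · exact ih h
    · exact cons (L.nec _ (ih h5)) h
    · exact ih h
    · exact cons (L.subst_mem _ _ (NormalLogic.mem_add _ _)) h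

/-- Rules only ask for the presence of premises. With steps never discarding formulas, this lets two
derivations be concatenated, as modus ponens requires. -/
theorem derivationStep_mono {φ : ModalFormula} {i : Instruction} {S T : List ModalFormula}
    (h : S ⊆ T) : derivationStep φ i S ⊆ derivationStep φ i T := by
  unfold derivationStep
  split_ifs <;> grind

theorem subset_derivationStep (φ : ModalFormula) (i : Instruction) (S : List ModalFormula) :
    S ⊆ derivationStep φ i S := by
  unfold derivationStep
  split_ifs <;> grind

theorem derive_subset_append_left (φ : ModalFormula) (l m : List Instruction) :
    derive φ l ⊆ derive φ (l ++ m) := by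
  induction l with
  | nil => simp [derive]
  | cons i l ih => exact derivationStep_mono ih

theorem derive_subset_append_right (φ : ModalFormula) (l m : List Instruction) :
    derive φ m ⊆ derive φ (l ++ m) := by
  induction l with
  | nil => simp
  | cons i l ih => exact fun a ha => subset_derivationStep φ i _ (ih ha)

theorem Derivable.exists_mem_derive {φ a : ModalFormula} (h : Derivable φ a) :
    ∃ l, a ∈ derive φ l := by
  induction h with
  | weak a b => exact ⟨[(0, (a, b, bot), [])], by simp [derive, derivationStep]⟩
  | distr a b c => exact ⟨[(1, (a, b, c), [])], by simp [derive, derivationStep]⟩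
  | dne a => exact ⟨[(2, (a, bot, bot), [])], by simp [derive, derivationStep]⟩
  | boxDistr a b => exact ⟨[(3, (a, b, bot), [])], by simp [derive, derivationStep]⟩
  | @mp a b _ _ ih₁ ih₂ =>
    obtain ⟨l, hl⟩ := ih₁
    obtain ⟨m, hm⟩ := ih₂
    -- The head of the list is carried out last, when both premises are available.
    refine ⟨(4, (a, b, bot), []) :: (l ++ m), ?_⟩
    have e (i) : derive φ (i :: (l ++ m)) = derivationStep φ i (derive φ (l ++ m)) := rfl
    simp [e, derivationStep, derive_subset_append_left φ l m hl,
      derive_subset_append_right φ l m hm]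
  | @nec a _ ih =>
    obtain ⟨l, hl⟩ := ih
    refine ⟨(5, (a, bot, bot), []) :: l, ?_⟩
    have e (i) : derive φ (i :: l) = derivationStep φ i (derive φ l) := rfl
    simp [e, derivationStep, hl]
  | inst σ =>
    obtain ⟨s, hs⟩ := exists_listSubst_eq σ φ
    exact ⟨[(6, (bot, bot, bot), s)], by simp [derive, derivationStep, hs]⟩

theorem mem_K_add_iff_exists_derive {φ a : ModalFormula} :
    a ∈ (NormalLogic.K.add φ).carrier ↔ ∃ l, a ∈ derive φ l :=
  ⟨fun h => (derivable_of_mem_K_add h).exists_mem_derive, fun ⟨_, h⟩ => mem_K_add_of_mem_derive h⟩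

/-! ### Search for certificates -/

/-- Two derivations, and a coded finite frame. -/
abbrev Certificate : Type :=
  (List Instruction × List Instruction) × ℕ × List ℕ

/-- The derivations of the certificate show that `φ` and `ψ` axiomatize the same logic. -/
def Certificate.Proves (c : Certificate) (φ ψ : ModalFormula) : Prop :=
  φ ∈ derive ψ c.1.1 ∧ ψ ∈ derive φ c.1.2

/-- The frame of the certificate distinguishes `φ` and `ψ`. -/
def Certificate.Refutes (c : Certificate) (φ ψ : ModalFormula) : Prop :=
  ¬ (CodeValid c.2.1 c.2.2 φ ↔ CodeValid c.2.1 c.2.2 ψ)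

theorem axiomatizationProblem_iff_exists_proves {φ ψ : ModalFormula} :
    AxiomatizationProblem NormalLogic.K φ ψ ↔ ∃ c : Certificate, c.Proves φ ψ := by
  rw [AxiomatizationProblem, le_antisymm_iff, NormalLogic.K_add_le_iff, NormalLogic.K_add_le_iff,
    mem_K_add_iff_exists_derive, mem_K_add_iff_exists_derive]
  exact ⟨fun ⟨⟨l, hl⟩, m, hm⟩ => ⟨((m, l), 0, []), hm, hl⟩, fun ⟨c, h, k⟩ => ⟨⟨_, k⟩, _, h⟩⟩

theorem not_axiomatizationProblem_of_refutes {φ ψ : ModalFormula} {c : Certificate}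
    (h : c.Refutes φ ψ) : ¬ AxiomatizationProblem NormalLogic.K φ ψ := by
  refine fun he => h ?_
  rw [codeValid_iff, codeValid_iff]
  -- Validity of `χ` in a frame depends only on the logic `K + χ`.
  have key (χ : ModalFormula) : Valid (codeRel c.2.1 c.2.2) χ ↔
      NormalLogic.K.add χ ≤ NormalLogic.ofFrame (codeRel c.2.1 c.2.2) :=
    (NormalLogic.K_add_le_iff (M := .ofFrame _)).symm
  rw [key, key, show NormalLogic.K.add ψ = NormalLogic.K.add φ from he]

theorem exists_refutes {φ ψ : ModalFormula} (h : IsUnionSplitting (NormalLogic.K.add φ))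
    (hne : ¬ AxiomatizationProblem NormalLogic.K φ ψ) : ∃ c : Certificate, c.Refutes φ ψ := by
  obtain ⟨H, _, Q, hQ⟩ := NormalLogic.exists_finite_frame_of_not_axiomatizationProblem h hne
  obtain ⟨n, r, hr⟩ := exists_code_of_finite Q
  exact ⟨(([], []), n, r), fun he => hQ (by rwa [hr, hr] at he)⟩

open Classical in
/-- The verdict on `φ` and `ψ` given by the certificate with code `k`, if any. -/
noncomputable def verdict (p : ModalFormula × ModalFormula) (k : ℕ) : Option ℕ :=
  (Encodable.decode k : Option Certificate).bind fun c =>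
    if c.Proves p.1 p.2 then some 1 else if c.Refutes p.1 p.2 then some 0 else none

theorem primrec_verdict : Primrec₂ verdict := by
  classical
  let C := ((ModalFormula × ModalFormula) × ℕ) × Certificate
  have h1 : Primrec fun q : C => q.1.1.1 := Primrec.fst.comp (Primrec.fst.comp Primrec.fst)
  have h2 : Primrec fun q : C => q.1.1.2 := Primrec.snd.comp (Primrec.fst.comp Primrec.fst)
  have hl : Primrec fun q : C => q.2.1.1 := Primrec.fst.comp (Primrec.fst.comp Primrec.snd)
  have hm : Primrec fun q : C => q.2.1.2 := Primrec.snd.comp (Primrec.fst.comp Primrec.snd)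
  have hr : Primrec fun q : C => q.2.2 := Primrec.snd.comp Primrec.snd
  have hp : PrimrecPred fun q : C => q.2.Proves q.1.1.1 q.1.1.2 :=
    (primrecRel_mem.comp (primrec_derive.comp h2 hl) h1).and
      (primrecRel_mem.comp (primrec_derive.comp h1 hm) h2)
  have hn : PrimrecPred fun q : C => q.2.Refutes q.1.1.1 q.1.1.2 :=
    ((primrecPred_codeValid.comp (Primrec.pair hr h1)).iff
      (primrecPred_codeValid.comp (Primrec.pair hr h2))).not
  exact Primrec.option_bind (Primrec.decode.comp Primrec.snd)
    (Primrec.ite hp (.const (some 1)) (Primrec.ite hn (.const (some 0)) (.const none))).to₂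

/-- Search for a verdict. -/
noncomputable def search (p : ModalFormula × ModalFormula) : Part ℕ :=
  Nat.rfindOpt (verdict p)

theorem partrec_search : Partrec search :=
  Partrec.rfindOpt primrec_verdict.to_comp

theorem exists_mem_verdict {φ ψ : ModalFormula} {c : Certificate}
    (h : c.Proves φ ψ ∨ c.Refutes φ ψ) : ∃ k n, n ∈ verdict (φ, ψ) k := by
  refine ⟨Encodable.encode c, ?_⟩
  simp only [verdict, Encodable.encodek, Option.bind_some]
  split_ifs
  · exact ⟨1, rfl⟩
  · exact ⟨0, rfl⟩
  · tauto

theorem verdict_sound {φ ψ : ModalFormula} {n k : ℕ} (h : n ∈ verdict (φ, ψ) k) :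
    n = 1 ∧ AxiomatizationProblem NormalLogic.K φ ψ ∨
      n = 0 ∧ ¬ AxiomatizationProblem NormalLogic.K φ ψ := by
  obtain ⟨c, -, h⟩ := Option.bind_eq_some_iff.1 h
  dsimp only at h
  split_ifs at h with hp hr
  · exact Or.inl ⟨(Option.some_inj.1 h).symm, axiomatizationProblem_iff_exists_proves.2 ⟨c, hp⟩⟩
  · exact Or.inr ⟨(Option.some_inj.1 h).symm, not_axiomatizationProblem_of_refutes hr⟩

/-- Verdicts are sound for every `φ`; being a union-splitting is needed only for termination when
the two logics differ. -/
theorem search_spec {φ : ModalFormula} (h : IsUnionSplitting (NormalLogic.K.add φ))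
    (ψ : ModalFormula) :
    (AxiomatizationProblem NormalLogic.K φ ψ → search (φ, ψ) = Part.some 1) ∧
      (¬ AxiomatizationProblem NormalLogic.K φ ψ → search (φ, ψ) = Part.some 0) := by
  have hdom : (search (φ, ψ)).Dom := by
    refine Nat.rfindOpt_dom.2 ?_
    by_cases ha : AxiomatizationProblem NormalLogic.K φ ψ
    · obtain ⟨c, hc⟩ := axiomatizationProblem_iff_exists_proves.1 ha
      exact exists_mem_verdict (Or.inl hc)
    · obtain ⟨c, hc⟩ := exists_refutes h ha
      exact exists_mem_verdict (Or.inr hc)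
  obtain ⟨n, hn⟩ := Part.dom_iff_mem.1 hdom
  obtain ⟨k, hk⟩ := Nat.rfindOpt_spec hn
  rw [Part.eq_some_iff.2 hn]
  rcases verdict_sound hk with ⟨rfl, ha⟩ | ⟨rfl, ha⟩
  · exact ⟨fun _ => rfl, fun hna => absurd ha hna⟩
  · exact ⟨fun h' => absurd h' ha, fun _ => rfl⟩

end ModalFormula

theorem Nat.Partrec.Code.Decides.computablePred {c : Nat.Partrec.Code} {p : ModalFormula → Prop}
    (h : c.Decides p) : ComputablePred p := by
  classical
  have hc : Partrec fun ψ : ModalFormula => c.eval (Encodable.encode ψ) :=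
    (Partrec.nat_iff.2 (Nat.Partrec.Code.exists_code.2 ⟨c, rfl⟩)).comp Computable.encode
  have heq : Computable₂ fun (_ : ModalFormula) (n : ℕ) => decide (n = 1) :=
    (Primrec.eq.comp Primrec.snd (.const 1)).decide.to_comp.to₂
  refine ⟨inferInstance, (hc.map heq).of_eq fun ψ => ?_⟩
  by_cases hp : p ψ
  · simp [(h ψ).1 hp, hp]
  · simp [(h ψ).2 hp, hp]

/-- If `K + φ` is a union-splitting in `NExt K`, its axiomatization problem is decidable; moreover
a decision procedure is obtained from `φ` by an algorithm. -/
theorem mainTheorem4 :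
    (∀ φ : ModalFormula, IsUnionSplitting (NormalLogic.K.add φ) →
      ComputablePred (AxiomatizationProblem NormalLogic.K φ)) ∧
    ∃ F : ModalFormula → Nat.Partrec.Code, Computable F ∧
      ∀ φ : ModalFormula, IsUnionSplitting (NormalLogic.K.add φ) →
        (F φ).Decides (AxiomatizationProblem NormalLogic.K φ) := by
  have hsearch : Partrec fun m : ℕ =>
      search (decodeFormula m.unpair.1, decodeFormula m.unpair.2) := by
    have hd : Computable decodeFormula := Computable.ofNat ModalFormula
    exact partrec_search.comp ((hd.comp (Computable.fst.comp Computable.unpair)).pair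
      (hd.comp (Computable.snd.comp Computable.unpair)))
  obtain ⟨c, hc⟩ := Nat.Partrec.Code.exists_code.1 (Partrec.nat_iff.1 hsearch)
  -- One program `c` searches for all pairs; fixing its first argument by currying is computable in
  -- `φ`, which gives the uniform procedure.
  have hF (φ : ModalFormula) (h : IsUnionSplitting (NormalLogic.K.add φ)) :
      (c.curry (Encodable.encode φ)).Decides (AxiomatizationProblem NormalLogic.K φ) := by
    intro ψ
    have : (c.curry (Encodable.encode φ)).eval (Encodable.encode ψ) = search (φ, ψ) := by
      rw [Nat.Partrec.Code.eval_curry, hc]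
      simp only [Nat.unpair_pair]
      exact congrArg₂ (fun a b => search (a, b)) (decode_encodeFormula φ) (decode_encodeFormula ψ)
    rw [this]
    exact search_spec h ψ
  exact ⟨fun φ h => (hF φ h).computablePred, fun φ => c.curry (Encodable.encode φ),
    (Nat.Partrec.Code.primrec₂_curry.comp (.const c) Primrec.encode).to_comp, hF⟩
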